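/- Let $n \ge 5$, let $S_n$ and $T_n$ be the symmetric group and the full transformation monoid on $\{1,\dots,n\}$, with maps acting on the right (so $fg$ means first $f$, then $g$), and let $\langle A \mid R\rangle$ be any monoid presentation for $S_n$. Let $\zeta \notin A$. Then $T_n$ is defined by the monoid presentation with generators $A \cup \{\zeta\}$ and relations $R$ together with the following five relations: \begin{align*} &\zeta(1,3)\zeta(1,3) = \zeta;\\ &(3,4)\zeta = \zeta(3,4);\\ &(1,n)(2,3)\zeta(1,n)(2,3)\zeta = \zeta(1,n)(2,3)\zeta(1,n)(2,3);\\ &(2,3)\zeta(2,3)\zeta(2,3)\zeta(2,3) = \zeta(2,3)\zeta;\\ &(3,4,\dots,n)(1,2)\zeta = \zeta(3,4,\dots,n). \end{align*} Here the permutations written in disjoint cycle notation denote any words over $A$ representing these permutations, the elements of $A$ represent the same permutations in $T_n$ as in $S_n$, and $\zeta$ represents the idempotent of rank $n-1$ that maps $2$ to $1$ and fixes every other point. -/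

import Mathlib

/-- The symmetric group `S_n`, acting on the right: `σ * τ` means first `σ`, then `τ`. -/
abbrev SymGroup (n : ℕ) : Type := (Equiv.Perm (Fin n))ᵐᵒᵖ

/-- The full transformation monoid `T_n`, acting on the right: `f * g` means first `f`,
then `g`. -/
abbrev TransMonoid (n : ℕ) : Type := (Function.End (Fin n))ᵐᵒᵖ

/-- The inclusion of `S_n` in `T_n`. -/
def permToTrans {n : ℕ} (σ : SymGroup n) : TransMonoid n :=
  MulOpposite.op (fun x => σ.unop x)

/-- The point `i` of `{1, …, n}`, which is modelled by `Fin n`, so that `i` has index `i - 1`. -/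
def pt {n : ℕ} (i : ℕ) (h : 1 ≤ i ∧ i ≤ n) : Fin n := ⟨i - 1, by omega⟩

/-- The transposition `(i, j)`. -/
def transp {n : ℕ} (i j : ℕ) (hi : 1 ≤ i ∧ i ≤ n) (hj : 1 ≤ j ∧ j ≤ n) : SymGroup n :=
  MulOpposite.op (Equiv.swap (pt i hi) (pt j hj))

/-- The cycle `(3, 4, …, n)`: the list of all points in increasing order with `1` and `2`
removed, read as a cycle. -/
def longCycle (n : ℕ) : SymGroup n :=
  MulOpposite.op ((List.finRange n).drop 2).formPerm

/-- The idempotent of `T_n` of rank `n - 1` that maps `2` to `1` and fixes all other points. -/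
def idem (n : ℕ) (hn : 5 ≤ n) : TransMonoid n :=
  MulOpposite.op (fun x => if x = pt 2 (by omega) then pt 1 (by omega) else x)

/-- Words over `A`, regarded as words over `A ∪ {ζ}`; here `A ∪ {ζ}` is `Option A`. -/
def liftWord {A : Type*} : FreeMonoid A →* FreeMonoid (Option A) :=
  FreeMonoid.map some

/-- The new generator `ζ`, as a word over `A ∪ {ζ}`. -/
def zeta {A : Type*} : FreeMonoid (Option A) := FreeMonoid.of none

/-- The relations over `A ∪ {ζ}`: those of `R`, and five more. The words `p i`, `q i`, `r i`,
`s i`, `t`, `u` stand for the occurrences, in order, of the permutations `(1, 3)`, `(3, 4)`,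
`(1, n)(2, 3)`, `(2, 3)`, `(3, 4, …, n)(1, 2)` and `(3, 4, …, n)`. -/
inductive TransRels {A : Type*} (R : FreeMonoid A → FreeMonoid A → Prop)
    (p q : Fin 2 → FreeMonoid A) (r : Fin 4 → FreeMonoid A) (s : Fin 5 → FreeMonoid A)
    (t u : FreeMonoid A) : FreeMonoid (Option A) → FreeMonoid (Option A) → Prop
  | ofBase {v w : FreeMonoid A} (h : R v w) :
      TransRels R p q r s t u (liftWord v) (liftWord w)
  | rel1 : TransRels R p q r s t u
      (zeta * liftWord (p 0) * zeta * liftWord (p 1))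
      zeta
  | rel3 : TransRels R p q r s t u
      (liftWord (q 0) * zeta)
      (zeta * liftWord (q 1))
  | rel7 : TransRels R p q r s t u
      (liftWord (r 0) * zeta * liftWord (r 1) * zeta)
      (zeta * liftWord (r 2) * zeta * liftWord (r 3))
  | rel8 : TransRels R p q r s t u
      (liftWord (s 0) * zeta * liftWord (s 1) * zeta * liftWord (s 2) * zeta * liftWord (s 3))
      (zeta * liftWord (s 4) * zeta)
  | rel9 : TransRels R p q r s t u
      (liftWord t * zeta)
      (zeta * liftWord u)

/-!
Compose maps from right to left, and let `e i j` be the conjugate of `ζ` by a permutation taking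
`1` to `i` and `2` to `j`. It is well defined: by the last relation, conjugation by the cycle
`z = (3, 4, …, n)` turns `ζ` into `ζ (1, 2)`, so the centralizer of `ζ` in the stabilizer of `1` and
`2` is normalized by `z`; as it contains `(3, 4)`, it is the whole stabilizer. It therefore contains
`z`, which gives `ζ (1, 2) = ζ`, and conjugation transports every relation to all indices.

Any element `w` then satisfies `e i j * w = w` if its action avoids `j`, and `w * e i j = w` if its
action identifies `i ≠ j`. For a given map `f`, take `u` with the smallest possible image such that
`w * u = w` for all `w` acting as `f`. By minimality `f` is injective on the image of `u`, whence
`w * u = σ * u` for a permutation `σ`. For another `w'` acting as `f`, with permutation `τ`, the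
quotient `τ⁻¹ * σ` fixes the image of `u`, hence `τ⁻¹ * σ * u = u` and `w = w'`. So the homomorphism
onto `T_n` is injective.
-/

open Equiv

section FunctionEnd

variable {α : Type*} [DecidableEq α]

lemma mem_of_forall_swap_apply_mem [Finite α] {H : Submonoid (Perm α)} {σ : Perm α}
    (h : ∀ x, swap x (σ x) ∈ H) : σ ∈ H := by
  let S : Set (Perm α) := {τ | τ.IsSwap ∧ ∃ x, τ = swap x (σ x)}
  have hS : ∀ x, swap x (σ x) ∈ Subgroup.closure S := fun x => by
    by_cases hx : x = σ x
    · rw [← hx, swap_self]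
      exact one_mem _
    · exact Subgroup.subset_closure ⟨⟨x, σ x, hx, rfl⟩, x, rfl⟩
  have hσ : σ ∈ Subgroup.closure S :=
    (mem_closure_isSwap fun _ hτ => hτ.1).2
      ⟨Set.toFinite _, fun x => ⟨⟨swap x (σ x), hS x⟩, swap_apply_left x (σ x)⟩⟩
  rw [← Subgroup.mem_toSubmonoid, Subgroup.closure_toSubmonoid_of_finite] at hσ
  refine Submonoid.closure_le.2 ?_ hσ
  rintro _ ⟨-, x, rfl⟩
  exact h x

/-- The idempotent transformation sending `j` to `i` and fixing every other point. -/
def collapse (i j : α) : Function.End α := fun x => if x = j then i else x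

lemma collapse_apply (i j x : α) : collapse i j x = if x = j then i else x := rfl

lemma range_ssubset_range_update {β : Type*} {f : α → β} {a b : α} {k : β} (hk : k ∉ Set.range f)
    (hab : f a = f b) (hne : a ≠ b) : Set.range f ⊂ Set.range (Function.update f b k) := by
  refine (Set.ssubset_iff_of_subset ?_).2 ⟨k, ⟨b, Function.update_self b k f⟩, hk⟩
  rintro _ ⟨x, rfl⟩
  by_cases hx : x = b
  · exact ⟨a, by rw [Function.update_of_ne hne, hab, hx]⟩
  · exact ⟨x, Function.update_of_ne hx k f⟩

lemma exists_range_ssubset_and_collapse_apply_eq [Finite α] {f : α → α}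
    (hf : ¬Function.Injective f) :
    ∃ (i k : α) (g : α → α), i ≠ k ∧ Set.range f ⊂ Set.range g ∧ ∀ x, collapse i k (g x) = f x := by
  obtain ⟨a, b, hab, hne⟩ : ∃ a b, f a = f b ∧ a ≠ b := by simpa [Function.Injective] using hf
  obtain ⟨k, hk⟩ : ∃ k, k ∉ Set.range f := by
    rwa [← Set.ne_univ_iff_exists_notMem, Ne, Set.range_eq_univ, ← Finite.injective_iff_surjective]
  refine ⟨f a, k, Function.update f b k, fun h => hk ⟨a, h⟩,
    range_ssubset_range_update hk hab hne, fun x => ?_⟩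
  have hx : f x ≠ k := fun h => hk ⟨x, h⟩
  rw [collapse_apply, Function.update_apply]
  by_cases hxb : x = b <;> simp [hxb, hab, hx]

lemma eq_top_of_perm_mem_of_collapse_mem [Finite α] {M : Submonoid (Function.End α)}
    (hperm : ∀ σ : Perm α, MulAction.toEndHom σ ∈ M)
    (hcollapse : ∀ i j, i ≠ j → collapse i j ∈ M) : M = ⊤ := by
  refine eq_top_iff.2 fun f _ => ?_
  induction hr : Set.range f using WellFoundedGT.induction generalizing f with
  | _ r ih =>
    by_cases hf : Function.Injective f
    · exact hperm (Equiv.ofBijective f (Finite.injective_iff_bijective.1 hf))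
    · obtain ⟨i, k, g, hik, hfg, hg⟩ := exists_range_ssubset_and_collapse_apply_eq hf
      have hmul : collapse i k * (show Function.End α from g) = f := funext hg
      exact hmul ▸ M.mul_mem (hcollapse i k hik) (ih _ (hr ▸ hfg) g trivial rfl)

end FunctionEnd

/-- A monoid `N` acting on `α` and generated by elements `perm σ` and `e i j` which act as the
permutation `σ` and as `collapse i j`, and which satisfy enough relations to be determined by
their action (`CollapseSystem.eq_of_smul_eq`). The values `e i i` are irrelevant. -/
structure CollapseSystem (α N : Type*) [DecidableEq α] [Monoid N] [MulAction N α] where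
  perm : Perm α →* N
  e : α → α → N
  perm_smul (σ : Perm α) (x : α) : perm σ • x = σ x
  e_smul {i j : α} (hij : i ≠ j) (x : α) : e i j • x = collapse i j x
  closure_eq_top : Submonoid.closure (Set.range perm ∪ {w | ∃ i j, i ≠ j ∧ e i j = w}) = ⊤
  perm_mul_e (σ : Perm α) {i j : α} (hij : i ≠ j) : perm σ * e i j = e (σ i) (σ j) * perm σ
  e_mul_perm_swap {i j : α} (hij : i ≠ j) : e i j * perm (swap i j) = e i j
  e_mul_e_same_right {i j k : α} (hij : i ≠ j) (hkj : k ≠ j) : e k j * e i j = e i j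
  commute_e_of_nodup {i j k l : α} (h : [i, j, k, l].Nodup) : Commute (e i j) (e k l)
  e_mul_e_mul_e {i j k : α} (h : [i, j, k].Nodup) :
    e i k * e i j * e i k = e i j * perm (swap j k) * e i j

namespace CollapseSystem

variable {α N : Type*} [DecidableEq α] [Monoid N] [MulAction N α] (S : CollapseSystem α N)
  {i j k l : α}

lemma perm_swap_mul_e (hij : i ≠ j) : S.perm (swap i j) * S.e i j = S.e j i := by
  rw [S.perm_mul_e _ hij, swap_apply_left, swap_apply_right, swap_comm, S.e_mul_perm_swap hij.symm]

lemma perm_mul_cancel_left {σ : Perm α} {x y : N} (h : S.perm σ * x = S.perm σ * y) : x = y := by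
  simpa [← mul_assoc, ← map_mul] using congrArg (S.perm σ⁻¹ * ·) h

lemma e_mul_e_mul_e_eq_perm_swap_mul (h : [i, j, k].Nodup) :
    S.e i k * S.e i j * S.e i k = S.perm (swap j k) * (S.e i k * S.e i j) := by
  obtain ⟨hij, hik, -⟩ : i ≠ j ∧ i ≠ k ∧ j ≠ k := by simpa [and_assoc] using h
  rw [S.e_mul_e_mul_e h, ← mul_assoc, S.perm_mul_e _ hik, swap_apply_of_ne_of_ne hij hik,
    swap_apply_right]

lemma e_mul_e_mul_e_eq (h : [i, j, k].Nodup) :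
    S.e i j * S.e i k * S.e i j = S.e i k * S.e i j := by
  obtain ⟨hij, hik, -⟩ : i ≠ j ∧ i ≠ k ∧ j ≠ k := by simpa [and_assoc] using h
  have hmove : S.e i k * S.perm (swap j k) = S.perm (swap j k) * S.e i j := by
    rw [S.perm_mul_e _ hij, swap_apply_of_ne_of_ne hij hik, swap_apply_left]
  refine S.perm_mul_cancel_left (σ := swap j k) ?_
  calc S.perm (swap j k) * (S.e i j * S.e i k * S.e i j)
      = S.e i k * (S.perm (swap j k) * (S.e i k * S.e i j)) := by
        simp only [← mul_assoc, hmove]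
    _ = S.e i k * S.e i k * S.e i j * S.e i k := by
        rw [← S.e_mul_e_mul_e_eq_perm_swap_mul h]; simp only [mul_assoc]
    _ = S.perm (swap j k) * (S.e i k * S.e i j) := by
        rw [S.e_mul_e_same_right hik hik, S.e_mul_e_mul_e_eq_perm_swap_mul h]

lemma commute_e_same_left (h : [i, j, k].Nodup) : Commute (S.e i j) (S.e i k) := by
  obtain ⟨hij, hik, hjk⟩ : i ≠ j ∧ i ≠ k ∧ j ≠ k := by simpa [and_assoc] using h
  have habsorb : S.perm (swap j k) * (S.e i k * S.e i j) = S.e i k * S.e i j :=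
    calc S.perm (swap j k) * (S.e i k * S.e i j)
        = S.perm (swap j k) * (S.e i k * S.e i j) * S.e i j := by
          simp only [mul_assoc, S.e_mul_e_same_right hij hij]
      _ = S.e i k * (S.e i j * S.e i k * S.e i j) := by
          rw [← S.e_mul_e_mul_e_eq_perm_swap_mul h]; simp only [mul_assoc]
      _ = S.e i k * S.e i j := by
          rw [S.e_mul_e_mul_e_eq h, ← mul_assoc, S.e_mul_e_same_right hik hik]
  calc S.e i j * S.e i k
      = S.e i k * S.e i j * S.e i k :=
        (S.e_mul_e_mul_e_eq (by simp [hij, hik, hjk.symm])).symm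
    _ = S.e i k * S.e i j := by rw [S.e_mul_e_mul_e_eq_perm_swap_mul h, habsorb]

lemma commute_e (hij : i ≠ j) (hil : i ≠ l) (hkj : k ≠ j) (hkl : k ≠ l) (hjl : j ≠ l) :
    Commute (S.e i j) (S.e k l) := by
  obtain rfl | hik := eq_or_ne i k
  · exact S.commute_e_same_left (by simp [hij, hil, hjl])
  · exact S.commute_e_of_nodup (by simp [hij, hik, hil, hkj.symm, hjl, hkl])

lemma e_mul_e_eq_e_mul_e (h : [i, j, k].Nodup) : S.e i j * S.e j k = S.e i k * S.e i j := by
  obtain ⟨hij, hik, hjk⟩ : i ≠ j ∧ i ≠ k ∧ j ≠ k := by simpa [and_assoc] using h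
  calc S.e i j * S.e j k
      = S.e i j * S.perm (swap i j) * S.e j k := by rw [S.e_mul_perm_swap hij]
    _ = S.e i j * S.e i k * S.perm (swap i j) := by
        rw [mul_assoc, S.perm_mul_e _ hjk, swap_apply_right,
          swap_apply_of_ne_of_ne hik.symm hjk.symm, mul_assoc]
    _ = S.e i k * S.e i j := by
        rw [(S.commute_e_same_left h).eq, mul_assoc, S.e_mul_perm_swap hij]

@[elab_as_elim]
lemma induction_left {motive : N → Prop} (w : N) (one : motive 1)
    (perm_mul : ∀ σ w, motive w → motive (S.perm σ * w))
    (e_mul : ∀ i j, i ≠ j → ∀ w, motive w → motive (S.e i j * w)) : motive w := by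
  have hw : w ∈ Submonoid.closure (Set.range S.perm ∪ {w | ∃ i j, i ≠ j ∧ S.e i j = w}) :=
    S.closure_eq_top ▸ trivial
  induction hw using Submonoid.closure_induction_left with
  | one => exact one
  | mul_left x hx y _ ih =>
    obtain ⟨σ, rfl⟩ | ⟨i, j, hij, rfl⟩ := hx
    · exact perm_mul σ y ih
    · exact e_mul i j hij y ih

lemma e_mul_perm (σ : Perm α) (hij : i ≠ j) :
    S.e i j * S.perm σ = S.perm σ * S.e (σ.symm i) (σ.symm j) := by
  rw [S.perm_mul_e σ (σ.symm.injective.ne hij), apply_symm_apply, apply_symm_apply]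

lemma e_smul_of_ne (hij : i ≠ j) {x : α} (hx : x ≠ j) : S.e i j • x = x := by
  rw [S.e_smul hij, collapse_apply, if_neg hx]

lemma e_smul_self (hij : i ≠ j) : S.e i j • j = i := by
  rw [S.e_smul hij, collapse_apply, if_pos rfl]

lemma e_smul_ne (hij : i ≠ j) (x : α) : S.e i j • x ≠ j := by
  obtain rfl | hx := eq_or_ne x j
  · rwa [S.e_smul_self hij]
  · rwa [S.e_smul_of_ne hij hx]

lemma e_mul_of_forall_smul_ne {w : N} (hij : i ≠ j) (hw : ∀ x : α, w • x ≠ j) :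
    S.e i j * w = w := by
  induction w using S.induction_left generalizing i j with
  | one => exact absurd (one_smul N j) (hw j)
  | perm_mul σ w ih =>
    have hw' : ∀ x : α, w • x ≠ σ.symm j := fun x hx =>
      hw x (by rw [mul_smul, hx, S.perm_smul, apply_symm_apply])
    rw [← mul_assoc, S.e_mul_perm σ hij, mul_assoc, ih (σ.symm.injective.ne hij) hw']
  | e_mul a b hab w ih =>
    obtain rfl | hjb := eq_or_ne j b
    · rw [← mul_assoc, S.e_mul_e_same_right hab hij]
    have hwj : ∀ x : α, w • x ≠ j := fun x hx =>
      hw x (by rw [mul_smul, hx, S.e_smul_of_ne hab hjb])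
    obtain rfl | hja := eq_or_ne j a
    · have hwb : ∀ x : α, w • x ≠ b := fun x hx =>
        hw x (by rw [mul_smul, hx, S.e_smul_self hab])
      rw [ih hab hwb, ih hij hwj]
    have hcomm : Commute (S.e a j) (S.e a b) := S.commute_e hja.symm hab hja.symm hab hjb
    obtain rfl | hib := eq_or_ne i b
    · calc S.e i j * (S.e a i * w)
          = S.e i j * (S.e a i * S.e a j * w) := by rw [mul_assoc, ih hja.symm hwj]
        _ = S.e i j * S.e a j * S.e a i * w := by rw [← hcomm.eq]; simp only [mul_assoc]
        _ = S.e a i * (S.e a j * w) := by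
            rw [S.e_mul_e_same_right hja.symm hij, hcomm.eq, mul_assoc]
        _ = S.e a i * w := by rw [ih hja.symm hwj]
    · rw [← mul_assoc, (S.commute_e hij hib hja.symm hab hjb).eq, mul_assoc, ih hij hwj]

lemma e_collapse_mul_e_mul_e {a b : α} (hab : a ≠ b) (h : collapse a b i ≠ collapse a b j) :
    S.e (collapse a b i) (collapse a b j) * S.e a b * S.e i j =
      S.e (collapse a b i) (collapse a b j) * S.e a b := by
  have hij : i ≠ j := fun hij => h (hij ▸ rfl)
  obtain rfl | hib := eq_or_ne i b
  · have haj : a ≠ j := by simpa [collapse_apply, hij.symm] using h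
    simp only [collapse_apply, if_true, if_neg hij.symm]
    rw [mul_assoc, S.e_mul_e_eq_e_mul_e (by simp [*]), ← mul_assoc, S.e_mul_e_same_right haj haj]
  obtain rfl | hjb := eq_or_ne j b
  · have hia : i ≠ a := by simpa [collapse_apply, hij] using h
    simp only [collapse_apply, if_true, if_neg hij]
    rw [S.e_mul_e_eq_e_mul_e (by simp [*]), S.e_mul_e_mul_e_eq (by simp [*, hab.symm]),
      S.commute_e_same_left (by simp [*])]
  simp only [collapse_apply, if_neg hib, if_neg hjb]
  obtain rfl | hja := eq_or_ne j a
  · rw [S.e_mul_e_eq_e_mul_e (by simp [*]), mul_assoc, S.e_mul_e_same_right hij hij]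
  · rw [(S.commute_e hij hib hja.symm hab hjb).eq, mul_assoc, S.e_mul_e_same_right hij hij]

lemma e_smul_mul_mul_e {w : N} (hw : w • k ≠ w • l) :
    S.e (w • k) (w • l) * w * S.e k l = S.e (w • k) (w • l) * w := by
  induction w using S.induction_left with
  | one =>
    have hkl : k ≠ l := by simpa using hw
    simp [S.e_mul_e_same_right hkl hkl]
  | perm_mul σ w ih =>
    have hw' : w • k ≠ w • l := fun h => hw (by rw [mul_smul, mul_smul, h])
    simp only [mul_smul, S.perm_smul, ← mul_assoc, ← S.perm_mul_e σ hw']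
    rw [mul_assoc, mul_assoc, ← mul_assoc (S.e _ _), ih hw', mul_assoc]
  | e_mul a b hab w ih =>
    have hw' : w • k ≠ w • l := fun h => hw (by rw [mul_smul, mul_smul, h])
    simp only [mul_smul, S.e_smul hab] at hw ⊢
    have habsorb := S.e_collapse_mul_e_mul_e hab hw
    rw [← mul_assoc, ← habsorb, mul_assoc, mul_assoc, ← mul_assoc (S.e (w • k) _), ih hw',
      ← mul_assoc]

lemma mul_e_of_smul_eq {w : N} (hkl : k ≠ l) (hw : w • k = w • l) : w * S.e k l = w := by
  induction w using S.induction_left with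
  | one => exact absurd (by simpa using hw) hkl
  | perm_mul σ w ih =>
    simp only [mul_smul, S.perm_smul, σ.injective.eq_iff] at hw
    rw [mul_assoc, ih hw]
  | e_mul a b hab w ih =>
    by_cases hw' : w • k = w • l
    · rw [mul_assoc, ih hw']
    have habsorb := S.e_smul_mul_mul_e hw'
    obtain ⟨hk, hl⟩ | ⟨hk, hl⟩ : (w • k = a ∧ w • l = b) ∨ (w • k = b ∧ w • l = a) := by
      simp only [mul_smul, S.e_smul hab, collapse_apply] at hw
      grind
    · rwa [hk, hl] at habsorb
    · rw [hk, hl] at habsorb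
      rw [← S.perm_swap_mul_e hab.symm, mul_assoc, mul_assoc, ← mul_assoc (S.e b a), habsorb,
        mul_assoc]

lemma perm_swap_mul_of_forall_smul_ne {w : N} (hij : i ≠ j) (hi : ∀ x : α, w • x ≠ i)
    (hj : ∀ x : α, w • x ≠ j) : S.perm (swap i j) * w = w :=
  calc S.perm (swap i j) * w
      = S.perm (swap i j) * S.e i j * w := by rw [mul_assoc, S.e_mul_of_forall_smul_ne hij hj]
    _ = w := by rw [S.perm_swap_mul_e hij, S.e_mul_of_forall_smul_ne hij.symm hi]

lemma perm_mul_of_forall_apply_smul [Finite α] {σ : Perm α} {w : N}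
    (h : ∀ x : α, σ (w • x) = w • x) : S.perm σ * w = w := by
  suffices hσ : σ ∈ (MulAction.stabilizerSubmonoid N w).comap S.perm from hσ
  refine mem_of_forall_swap_apply_mem fun x => ?_
  obtain hx | hx := eq_or_ne x (σ x)
  · rw [← hx, swap_self]
    exact one_mem _
  · refine S.perm_swap_mul_of_forall_smul_ne hx (fun y hy => hx ?_) fun y hy => hx ?_
    · rw [← hy, h]
    · exact σ.injective (by rw [← hy, h])

lemma exists_mul_eq_perm_mul {w u : N} (h : ∀ x y : α, w • u • x = w • u • y → u • x = u • y) :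
    ∃ σ, w * u = S.perm σ * u := by
  induction w using S.induction_left with
  | one => exact ⟨1, by rw [map_one]⟩
  | perm_mul τ w ih =>
    obtain ⟨σ, hσ⟩ := ih fun x y hxy => h x y (by rw [mul_smul, hxy, mul_smul])
    exact ⟨τ * σ, by rw [mul_assoc, hσ, map_mul, mul_assoc]⟩
  | e_mul i j hij w ih =>
    obtain ⟨σ, hσ⟩ := ih fun x y hxy => h x y (by rw [mul_smul, hxy, mul_smul])
    have hij' : σ.symm i ≠ σ.symm j := σ.symm.injective.ne hij
    have hmul : S.e i j * w * u = S.perm σ * (S.e (σ.symm i) (σ.symm j) * u) := by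
      rw [mul_assoc, hσ, ← mul_assoc, S.e_mul_perm σ hij, mul_assoc]
    by_cases hj : ∀ x : α, u • x ≠ σ.symm j
    · exact ⟨σ, by rw [hmul, S.e_mul_of_forall_smul_ne hij' hj]⟩
    by_cases hi : ∀ x : α, u • x ≠ σ.symm i
    · refine ⟨σ * swap (σ.symm j) (σ.symm i), ?_⟩
      rw [hmul, ← S.perm_swap_mul_e hij'.symm, mul_assoc, S.e_mul_of_forall_smul_ne hij'.symm hi,
        map_mul, mul_assoc]
    push Not at hi hj
    obtain ⟨⟨x, hx⟩, y, hy⟩ := And.intro hi hj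
    have hwu : ∀ z : α, w • u • z = σ (u • z) := fun z => by
      rw [← mul_smul, hσ, mul_smul, S.perm_smul]
    refine absurd (h x y ?_) (by rwa [hx, hy])
    rw [mul_smul, mul_smul, hwu, hwu, hx, hy, apply_symm_apply, apply_symm_apply,
      S.e_smul_self hij, S.e_smul_of_ne hij hij]

lemma exists_forall_mul_eq [Finite α] (S : CollapseSystem α N) (f : α → α) :
    ∃ u : N, (∀ w : N, (∀ x : α, w • x = f x) → w * u = w) ∧
      ∀ x y : α, f (u • x) = f (u • y) → u • x = u • y := by
  let A : Set N := {u | ∀ w : N, (∀ x : α, w • x = f x) → w * u = w}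
  obtain ⟨u, hu, hmin⟩ := (InvImage.wf (fun u : N => Set.range fun x : α => u • x)
    (wellFounded_lt (α := Set α))).has_min A ⟨1, fun w _ => mul_one w⟩
  refine ⟨u, hu, fun x y hf => by_contra fun hxy => hmin (S.e (u • x) (u • y) * u) ?_ ?_⟩
  · intro w hw
    rw [← mul_assoc, S.mul_e_of_smul_eq hxy (by rw [hw, hw, hf]), hu w hw]
  · refine (Set.ssubset_iff_of_subset ?_).2 ⟨u • y, ⟨y, rfl⟩, ?_⟩
    · rintro _ ⟨z, rfl⟩
      obtain hz | hz := eq_or_ne (u • z) (u • y)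
      · exact ⟨x, by simp [mul_smul, hz, S.e_smul_self hxy]⟩
      · exact ⟨z, by simp [mul_smul, S.e_smul_of_ne hxy hz]⟩
    · rintro ⟨z, hz⟩
      exact S.e_smul_ne hxy _ ((mul_smul _ _ _).symm.trans hz)

lemma eq_of_smul_eq [Finite α] (S : CollapseSystem α N) {w w' : N}
    (h : ∀ x : α, w • x = w' • x) : w = w' := by
  obtain ⟨u, hu, hinj⟩ := S.exists_forall_mul_eq (w • · : α → α)
  obtain ⟨σ, hσ⟩ := S.exists_mul_eq_perm_mul hinj
  obtain ⟨τ, hτ⟩ := S.exists_mul_eq_perm_mul (w := w') (u := u) (by simpa only [← h] using hinj)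
  have hστ : S.perm (τ⁻¹ * σ) * u = u := by
    refine S.perm_mul_of_forall_apply_smul fun x => ?_
    rw [Perm.mul_apply, Perm.inv_eq_iff_eq, ← S.perm_smul, ← S.perm_smul, ← mul_smul, ← mul_smul,
      ← hσ, ← hτ, mul_smul, mul_smul, h]
  calc w = S.perm σ * u := by rw [← hσ, hu w fun _ => rfl]
    _ = S.perm τ * (S.perm (τ⁻¹ * σ) * u) := by rw [← mul_assoc, ← map_mul, mul_inv_cancel_left]
    _ = w' := by rw [hστ, ← hτ, hu w' fun x => (h x).symm]

end CollapseSystem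

lemma exists_perm_map_eq {α : Type*} [Finite α] {l l' : List α} (hl : l.Nodup) (hl' : l'.Nodup)
    (hlength : l.length = l'.length) : ∃ σ : Perm α, l.map σ = l' := by
  obtain ⟨σ, hσ⟩ := Perm.exists_extending_pair l.get (l'.get ∘ Fin.cast hlength)
    (List.nodup_iff_injective_get.1 hl)
    ((List.nodup_iff_injective_get.1 hl').comp (Fin.cast_injective hlength))
  refine ⟨σ, List.ext_getElem (by simpa using hlength) fun m hm _ => ?_⟩
  simpa using hσ ⟨m, by simpa using hm⟩

lemma mem_of_isCycleOn_of_swap_mem {α : Type*} [DecidableEq α] [Finite α] {M : Submonoid (Perm α)}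
    {s : Set α} {z σ : Perm α} {c : α} (hz : z.IsCycleOn s) (hc : c ∈ s) (hswap : swap c (z c) ∈ M)
    (hconj : ∀ x ∈ s, ∀ y ∈ s, swap x y ∈ M → swap (z x) (z y) ∈ M) (hσ : ∀ x ∉ s, σ x = x) :
    σ ∈ M := by
  have hpow (k : ℕ) : (z ^ k) c ∈ s := hz.1.mapsTo.perm_pow k hc
  have hadj (k : ℕ) : swap ((z ^ k) c) ((z ^ (k + 1)) c) ∈ M := by
    induction k with
    | zero => exact hswap
    | succ k ih =>
      simpa only [pow_succ', Perm.mul_apply] using hconj _ (hpow k) _ (hpow (k + 1)) ih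
  have hstart (k : ℕ) : swap c ((z ^ k) c) ∈ M := by
    induction k with
    | zero => simp [← Perm.one_def]
    | succ k ih => exact SubmonoidClass.swap_mem_trans M ih (hadj k)
  refine mem_of_forall_swap_apply_mem fun x => ?_
  by_cases hx : x ∈ s
  · have hσx : σ x ∈ s := by
      by_contra h
      exact h (by rwa [σ.injective (hσ _ h)])
    obtain ⟨k, hk⟩ := hz.exists_pow_eq' s.toFinite hc hx
    obtain ⟨l, hl⟩ := hz.exists_pow_eq' s.toFinite hc hσx
    have hcx : swap x c ∈ M := by rw [swap_comm, ← hk]; exact hstart k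
    exact SubmonoidClass.swap_mem_trans M hcx (hl ▸ hstart l)
  · rw [hσ x hx, swap_self]
    exact one_mem M

section Conj

variable {G N : Type*} [Group G] [Monoid N]

/-- The action of a group `G` on a monoid `N` by conjugation, along a homomorphism `G →* N`. -/
def conjAut (P : G →* N) : G →* MulAut N :=
  (MulDistribMulAction.toMulAut (ConjAct Nˣ) N).comp
    (ConjAct.toConjAct.toMonoidHom.comp P.toHomUnits)

variable (P : G →* N) (g h : G) (x : N)

lemma conjAut_apply : conjAut P g x = P g * x * P g⁻¹ := rfl

lemma conjAut_map : conjAut P g (P h) = P (g * h * g⁻¹) := by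
  rw [conjAut_apply, map_mul, map_mul]

lemma conjAut_mul_map : conjAut P g x * P g = P g * x := by
  rw [conjAut_apply, mul_assoc, ← map_mul, inv_mul_cancel, map_one, mul_one]

variable {P g x}

lemma conjAut_apply_of_mul_self (hg : g * g = 1) : conjAut P g x = P g * x * P g := by
  rw [conjAut_apply, inv_eq_of_mul_eq_one_left hg]

lemma conjAut_eq_self (h : Commute (P g) x) : conjAut P g x = x := by
  rw [conjAut_apply, h.eq, mul_assoc, ← map_mul, mul_inv_cancel, map_one, mul_one]

end Conj

section CollapseRelations

variable {α N : Type*} [DecidableEq α] [Monoid N]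

/-- The five relations of the theorem other than those of the symmetric group, for maps composed
from right to left. The points `a`, `b`, `c`, `d` play the roles of `1`, `2`, `3`, `n`, and `z` that
of the cycle `(3, 4, …, n)`, so that `z c` plays the role of `4`. -/
structure CollapseRelations (P : Perm α →* N) (ζ : N) (a b c d : α) (z : Perm α) : Prop where
  conjAut_mul : conjAut P (swap a c) ζ * ζ = ζ
  commute_swap : Commute (P (swap c (z c))) ζ
  commute_conjAut : Commute (conjAut P (swap b c * swap a d) ζ) ζ
  conjAut_mul_mul_conjAut :
    conjAut P (swap b c) ζ * ζ * conjAut P (swap b c) ζ = ζ * P (swap b c) * ζ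
  mul_swap_mul : ζ * P (swap a b * z) = P z * ζ

lemma collapseRelations_iff {P : Perm α →* N} {ζ : N} {a b c d : α} {z : Perm α}
    (habcd : [a, b, c, d].Nodup) :
    CollapseRelations P ζ a b c d z ↔
      P (swap a c) * ζ * P (swap a c) * ζ = ζ ∧
      ζ * P (swap c (z c)) = P (swap c (z c)) * ζ ∧
      ζ * P (swap b c * swap a d) * ζ * P (swap b c * swap a d) =
        P (swap b c * swap a d) * ζ * P (swap b c * swap a d) * ζ ∧
      P (swap b c) * ζ * P (swap b c) * ζ * P (swap b c) * ζ * P (swap b c) =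
        ζ * P (swap b c) * ζ ∧
      ζ * P (swap a b * z) = P z * ζ := by
  have hdisjoint : (swap a d).Disjoint (swap b c) := Perm.disjoint_swap_swap (by grind)
  have hsq : (swap b c * swap a d) * (swap b c * swap a d) = 1 := by
    rw [hdisjoint.commute.mul_mul_mul_comm, swap_mul_self, swap_mul_self, one_mul]
  have hac := conjAut_apply_of_mul_self (P := P) (x := ζ) (swap_mul_self a c)
  have hbc := conjAut_apply_of_mul_self (P := P) (x := ζ) (swap_mul_self b c)
  have hbcad := conjAut_apply_of_mul_self (P := P) (x := ζ) hsq
  constructor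
  · rintro ⟨h1, h2, h3, h4, h5⟩
    rw [hac] at h1
    rw [hbcad] at h3
    rw [hbc] at h4
    exact ⟨h1, h2.eq.symm, by simpa only [mul_assoc] using h3.eq.symm,
      by simpa only [mul_assoc] using h4, h5⟩
  · rintro ⟨h1, h2, h3, h4, h5⟩
    refine ⟨by rwa [hac], h2.symm, ?_, ?_, h5⟩
    · rw [hbcad]
      simpa only [commute_iff_eq, mul_assoc] using h3.symm
    · rw [hbc]
      simpa only [mul_assoc] using h4

lemma conjAut_collapse (σ : Perm α) (i j : α) :
    conjAut MulAction.toEndHom σ (collapse i j) = collapse (σ i) (σ j) := by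
  funext x
  change σ (collapse i j (σ.symm x)) = _
  rw [collapse_apply, collapse_apply, apply_ite σ, apply_symm_apply]
  simp only [σ.symm_apply_eq]

lemma collapseRelations_collapse {a b c d : α} {z : Perm α} (habcd : [a, b, c, d].Nodup)
    (hza : z a = a) (hzb : z b = b) :
    CollapseRelations MulAction.toEndHom (collapse a b) a b c d z := by
  have hza' (x : α) : z x = a ↔ x = a :=
    ⟨fun h => z.injective (h.trans hza.symm), fun h => h ▸ hza⟩
  have hzb' (x : α) : z x = b ↔ x = b :=
    ⟨fun h => z.injective (h.trans hzb.symm), fun h => h ▸ hzb⟩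
  have hmul (f g : Function.End α) (x : α) : (f * g) x = f (g x) := rfl
  have hperm (σ : Perm α) (x : α) : (MulAction.toEndHom σ : Function.End α) x = σ x := rfl
  have hext (f g : Function.End α) : f = g ↔ ∀ x, f x = g x := funext_iff
  constructor <;>
    simp only [conjAut_collapse, commute_iff_eq, hext, hmul, hperm, collapse_apply,
      Perm.mul_apply] <;>
    grind

namespace CollapseRelations

variable {P : Perm α →* N} {ζ : N} {a b c d : α} {z : Perm α}

lemma conjAut_eq (h : CollapseRelations P ζ a b c d z) : conjAut P z ζ = ζ * P (swap a b) := by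
  rw [conjAut_apply, ← h.mul_swap_mul, mul_assoc, ← map_mul, mul_inv_cancel_right]

lemma commute_conj_perm (h : CollapseRelations P ζ a b c d z) (hza : z a = a) (hzb : z b = b)
    {σ : Perm α} (hσa : σ a = a) (hσb : σ b = b) (hσ : Commute (P σ) ζ) :
    Commute (P (z * σ * z⁻¹)) ζ := by
  have hswap : Commute σ (swap a b) := by
    rw [Commute, SemiconjBy, ← mul_inv_eq_iff_eq_mul, ← swap_apply_apply, hσa, hσb]
  have hζ : conjAut P z (ζ * P (swap a b)) = ζ := by
    rw [map_mul, h.conjAut_eq, conjAut_map, ← swap_apply_apply, hza, hzb, mul_assoc, ← map_mul,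
      swap_mul_self, map_one, mul_one]
  rw [← conjAut_map, ← hζ]
  exact (hσ.mul_right (hswap.map P)).map (conjAut P z)

lemma commute_of_fix [Finite α] (h : CollapseRelations P ζ a b c d z) (hca : c ≠ a) (hcb : c ≠ b)
    (hza : z a = a) (hzb : z b = b) (hz : z.IsCycleOn {a, b}ᶜ) {σ : Perm α} (hσa : σ a = a)
    (hσb : σ b = b) : Commute (P σ) ζ := by
  let M : Submonoid (Perm α) := (Submonoid.centralizer {ζ}).comap P
  have mem_M {τ} : τ ∈ M ↔ Commute (P τ) ζ := by
    simp [M, Submonoid.mem_centralizer_iff, commute_iff_eq, eq_comm]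
  refine mem_M.1 (mem_of_isCycleOn_of_swap_mem hz (c := c) (by simp [hca, hcb])
    (mem_M.2 h.commute_swap) (fun x hx y hy hxy => mem_M.2 ?_) ?_)
  · rw [swap_apply_apply]
    simp only [Set.mem_compl_iff, Set.mem_insert_iff, Set.mem_singleton_iff, not_or] at hx hy
    exact h.commute_conj_perm hza hzb (swap_apply_of_ne_of_ne (Ne.symm hx.1) (Ne.symm hy.1))
      (swap_apply_of_ne_of_ne (Ne.symm hx.2) (Ne.symm hy.2)) (mem_M.1 hxy)
  · rintro x hx
    obtain rfl | rfl := not_not.1 hx <;> assumption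

lemma mul_swap [Finite α] (h : CollapseRelations P ζ a b c d z) (hca : c ≠ a) (hcb : c ≠ b)
    (hza : z a = a) (hzb : z b = b) (hz : z.IsCycleOn {a, b}ᶜ) : ζ * P (swap a b) = ζ := by
  rw [← h.conjAut_eq, conjAut_eq_self (h.commute_of_fix hca hcb hza hzb hz hza hzb)]

end CollapseRelations

/-- The conjugate of `x` by a permutation taking `a` to `i` and `b` to `j`, where `a ≠ b` and
`i ≠ j`. The choice of the permutation does not matter when `x` commutes with the stabilizer of
`a` and `b` (`conjAut_eq_pairConj`). -/
def pairConj (P : Perm α →* N) (x : N) (a b i j : α) : N :=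
  conjAut P (swap (swap a i b) j * swap a i) x

section PairConj

variable {P : Perm α →* N} {ζ : N} {a b i j : α}

lemma exists_pairConj_eq_conjAut (P : Perm α →* N) (x : N) (hab : a ≠ b) (hij : i ≠ j) :
    ∃ σ : Perm α, σ a = i ∧ σ b = j ∧ pairConj P x a b i j = conjAut P σ x := by
  refine ⟨_, ?_, ?_, rfl⟩
  · have hi : swap a i b ≠ i := fun h => hab ((swap a i).injective (by rw [h, swap_apply_left]))
    rw [Perm.mul_apply, swap_apply_left, swap_apply_of_ne_of_ne hi.symm hij]
  · rw [Perm.mul_apply, swap_apply_left]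

lemma conjAut_eq_pairConj (hfix : ∀ σ : Perm α, σ a = a → σ b = b → Commute (P σ) ζ)
    (hab : a ≠ b) {σ : Perm α} (ha : σ a = i) (hb : σ b = j) :
    conjAut P σ ζ = pairConj P ζ a b i j := by
  obtain ⟨τ, hτa, hτb, hτ⟩ :=
    exists_pairConj_eq_conjAut P ζ hab (show i ≠ j from ha ▸ hb ▸ σ.injective.ne hab)
  have hfixed : conjAut P (τ⁻¹ * σ) ζ = ζ := conjAut_eq_self <| hfix _
    (by rw [Perm.mul_apply, Perm.inv_eq_iff_eq, ha, hτa])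
    (by rw [Perm.mul_apply, Perm.inv_eq_iff_eq, hb, hτb])
  rw [hτ, ← mul_inv_cancel_left τ σ, map_mul, MulAut.mul_apply, hfixed]

lemma conjAut_pairConj (hfix : ∀ σ : Perm α, σ a = a → σ b = b → Commute (P σ) ζ)
    (hab : a ≠ b) (σ : Perm α) (hij : i ≠ j) :
    conjAut P σ (pairConj P ζ a b i j) = pairConj P ζ a b (σ i) (σ j) := by
  obtain ⟨τ, hτa, hτb, hτ⟩ := exists_pairConj_eq_conjAut P ζ hab hij
  rw [hτ, ← MulAut.mul_apply, ← map_mul]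
  exact conjAut_eq_pairConj hfix hab (by rw [Perm.mul_apply, hτa]) (by rw [Perm.mul_apply, hτb])

lemma pairConj_self (hfix : ∀ σ : Perm α, σ a = a → σ b = b → Commute (P σ) ζ) (hab : a ≠ b) :
    pairConj P ζ a b a b = ζ := by
  rw [← conjAut_eq_pairConj hfix hab (Perm.one_apply a) (Perm.one_apply b), map_one,
    MulAut.one_apply]

lemma map_pairConj {M : Type*} [Monoid M] (F : N →* M) (P : Perm α →* N) (x : N) (a b i j : α) :
    F (pairConj P x a b i j) = pairConj (F.comp P) (F x) a b i j := by
  rw [pairConj, pairConj, conjAut_apply, conjAut_apply, map_mul, map_mul]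
  rfl

lemma pairConj_collapse (hab : a ≠ b) (hij : i ≠ j) :
    pairConj MulAction.toEndHom (collapse a b) a b i j = collapse i j := by
  obtain ⟨σ, rfl, rfl, hσ⟩ := exists_pairConj_eq_conjAut MulAction.toEndHom (collapse a b) hab hij
  rw [hσ, conjAut_collapse]

lemma pairConj_mul_perm_swap (hswap : ζ * P (swap a b) = ζ) (hab : a ≠ b) (hij : i ≠ j) :
    pairConj P ζ a b i j * P (swap i j) = pairConj P ζ a b i j := by
  obtain ⟨σ, rfl, rfl, hσ⟩ := exists_pairConj_eq_conjAut P ζ hab hij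
  rw [hσ, swap_apply_apply, ← conjAut_map, ← map_mul, hswap]

end PairConj

namespace CollapseRelations

variable {P : Perm α →* N} {ζ : N} {a b c d i j k l : α} {z : Perm α}

lemma pairConj_mul_pairConj_of_nodup [Finite α] (h : CollapseRelations P ζ a b c d z)
    (hfix : ∀ σ : Perm α, σ a = a → σ b = b → Commute (P σ) ζ) (habc : [a, b, c].Nodup)
    (hijk : [i, j, k].Nodup) :
    pairConj P ζ a b k j * pairConj P ζ a b i j = pairConj P ζ a b i j := by
  obtain ⟨hab, -, hbc⟩ : a ≠ b ∧ a ≠ c ∧ b ≠ c := by simpa [and_assoc] using habc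
  obtain ⟨σ, hσ⟩ := exists_perm_map_eq habc hijk rfl
  obtain ⟨rfl, rfl, rfl⟩ : σ a = i ∧ σ b = j ∧ σ c = k := by simpa using hσ
  have hrel : pairConj P ζ a b c b * pairConj P ζ a b a b = pairConj P ζ a b a b := by
    rw [← conjAut_eq_pairConj hfix hab (swap_apply_left a c)
      (swap_apply_of_ne_of_ne hab.symm hbc), pairConj_self hfix hab, h.conjAut_mul]
  simpa only [map_mul, conjAut_pairConj hfix hab σ hab, conjAut_pairConj hfix hab σ hbc.symm]
    using congrArg (conjAut P σ) hrel

lemma pairConj_mul_pairConj [Finite α] (h : CollapseRelations P ζ a b c d z)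
    (hfix : ∀ σ : Perm α, σ a = a → σ b = b → Commute (P σ) ζ) (habc : [a, b, c].Nodup)
    (hij : i ≠ j) (hkj : k ≠ j) :
    pairConj P ζ a b k j * pairConj P ζ a b i j = pairConj P ζ a b i j := by
  obtain rfl | hki := eq_or_ne k i
  · obtain ⟨hab, hac, hbc⟩ : a ≠ b ∧ a ≠ c ∧ b ≠ c := by simpa [and_assoc] using habc
    obtain ⟨σ, hσa, hσb⟩ : ∃ σ : Perm α, σ a = k ∧ σ b = j := by
      simpa using exists_perm_map_eq (l := [a, b]) (l' := [k, j]) (by simpa) (by simpa) rfl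
    have hl : [k, j, σ c].Nodup := by
      subst hσa hσb
      simp [hab, hac, hbc]
    have hl' : [σ c, j, k].Nodup := List.nodup_reverse.2 hl
    have habsorb := h.pairConj_mul_pairConj_of_nodup hfix habc hl
    calc pairConj P ζ a b k j * pairConj P ζ a b k j
        = pairConj P ζ a b k j * pairConj P ζ a b (σ c) j * pairConj P ζ a b k j := by
          rw [mul_assoc, habsorb]
      _ = pairConj P ζ a b k j := by
          rw [h.pairConj_mul_pairConj_of_nodup hfix habc hl', habsorb]
  · exact h.pairConj_mul_pairConj_of_nodup hfix habc (by simp [hij, hki.symm, hkj.symm])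

lemma commute_pairConj [Finite α] (h : CollapseRelations P ζ a b c d z)
    (hfix : ∀ σ : Perm α, σ a = a → σ b = b → Commute (P σ) ζ) (habcd : [a, b, c, d].Nodup)
    (hijkl : [i, j, k, l].Nodup) :
    Commute (pairConj P ζ a b i j) (pairConj P ζ a b k l) := by
  obtain ⟨hab, hac, had, hbc, hbd, hcd⟩ : a ≠ b ∧ a ≠ c ∧ a ≠ d ∧ b ≠ c ∧ b ≠ d ∧ c ≠ d := by
    simpa [and_assoc] using habcd
  obtain ⟨σ, hσ⟩ := exists_perm_map_eq (l := [d, c, a, b]) (by simp [*, Ne.symm]) hijkl rfl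
  obtain ⟨rfl, rfl, rfl, rfl⟩ : σ d = i ∧ σ c = j ∧ σ a = k ∧ σ b = l := by simpa using hσ
  have hrel : Commute (pairConj P ζ a b d c) (pairConj P ζ a b a b) := by
    rw [← conjAut_eq_pairConj hfix hab (σ := swap b c * swap a d)
      (by rw [Perm.mul_apply, swap_apply_left, swap_apply_of_ne_of_ne hbd.symm hcd.symm])
      (by rw [Perm.mul_apply, swap_apply_of_ne_of_ne hab.symm hbd, swap_apply_left]),
      pairConj_self hfix hab]
    exact h.commute_conjAut
  simpa only [conjAut_pairConj hfix hab σ hab, conjAut_pairConj hfix hab σ hcd.symm]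
    using hrel.map (conjAut P σ)

lemma pairConj_mul_pairConj_mul_pairConj [Finite α] (h : CollapseRelations P ζ a b c d z)
    (hfix : ∀ σ : Perm α, σ a = a → σ b = b → Commute (P σ) ζ) (habc : [a, b, c].Nodup)
    (hijk : [i, j, k].Nodup) :
    pairConj P ζ a b i k * pairConj P ζ a b i j * pairConj P ζ a b i k =
      pairConj P ζ a b i j * P (swap j k) * pairConj P ζ a b i j := by
  obtain ⟨hab, hac, -⟩ : a ≠ b ∧ a ≠ c ∧ b ≠ c := by simpa [and_assoc] using habc
  obtain ⟨σ, hσ⟩ := exists_perm_map_eq habc hijk rfl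
  obtain ⟨rfl, rfl, rfl⟩ : σ a = i ∧ σ b = j ∧ σ c = k := by simpa using hσ
  have hrel : pairConj P ζ a b a c * pairConj P ζ a b a b * pairConj P ζ a b a c =
      pairConj P ζ a b a b * P (swap b c) * pairConj P ζ a b a b := by
    rw [← conjAut_eq_pairConj hfix hab (swap_apply_of_ne_of_ne hab hac) (swap_apply_left b c),
      pairConj_self hfix hab, h.conjAut_mul_mul_conjAut]
  simpa only [map_mul, conjAut_pairConj hfix hab σ hab, conjAut_pairConj hfix hab σ hac,
    conjAut_map, ← swap_apply_apply] using congrArg (conjAut P σ) hrel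

/-- The collapse system obtained from a monoid `N` generated by `ζ` and the image of `P`, in which
the relations hold and which acts on `α` as expected. -/
def collapseSystem [Finite α] [MulAction N α] (h : CollapseRelations P ζ a b c d z)
    (hfix : ∀ σ : Perm α, σ a = a → σ b = b → Commute (P σ) ζ) (hswap : ζ * P (swap a b) = ζ)
    (habcd : [a, b, c, d].Nodup) (hgen : Submonoid.closure (insert ζ (Set.range P)) = ⊤)
    (hP : (MulAction.toEndHom : N →* Function.End α).comp P = MulAction.toEndHom)
    (hζ : (MulAction.toEndHom ζ : Function.End α) = collapse a b) : CollapseSystem α N where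
  perm := P
  e := pairConj P ζ a b
  perm_smul σ x := congrFun (DFunLike.congr_fun hP σ) x
  e_smul {i j} hij x := by
    have hab : a ≠ b := by simp_all
    refine congrFun (?_ : MulAction.toEndHom (pairConj P ζ a b i j) = collapse i j) x
    rw [map_pairConj, hP, hζ, pairConj_collapse hab hij]
  closure_eq_top := by
    have hab : a ≠ b := by simp_all
    refine top_unique (hgen ▸ Submonoid.closure_mono (Set.insert_subset ?_ Set.subset_union_left))
    exact Or.inr ⟨a, b, hab, pairConj_self hfix hab⟩
  perm_mul_e σ {i j} hij := by
    have hab : a ≠ b := by simp_all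
    rw [← conjAut_pairConj hfix hab σ hij, conjAut_mul_map]
  e_mul_perm_swap hij := pairConj_mul_perm_swap hswap (by simp_all) hij
  e_mul_e_same_right hij hkj := h.pairConj_mul_pairConj hfix (by simp_all) hij hkj
  commute_e_of_nodup hijkl := h.commute_pairConj hfix habcd hijkl
  e_mul_e_mul_e hijk := h.pairConj_mul_pairConj_mul_pairConj hfix (by simp_all) hijk

lemma bijective [Finite α] (h : CollapseRelations P ζ a b c d z) (habcd : [a, b, c, d].Nodup)
    (hza : z a = a) (hzb : z b = b) (hz : z.IsCycleOn {a, b}ᶜ)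
    (hgen : Submonoid.closure (insert ζ (Set.range P)) = ⊤) {F : N →* Function.End α}
    (hP : F.comp P = MulAction.toEndHom) (hζ : F ζ = collapse a b) : Function.Bijective F := by
  obtain ⟨hca, hcb⟩ : c ≠ a ∧ c ≠ b := by grind
  let _ := MulAction.ofEndHom F
  let S : CollapseSystem α N := h.collapseSystem (fun _ => h.commute_of_fix hca hcb hza hzb hz)
    (h.mul_swap hca hcb hza hzb hz) habcd hgen hP hζ
  refine ⟨fun v w hvw => S.eq_of_smul_eq (congrFun hvw), MonoidHom.mrange_eq_top.1 ?_⟩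
  refine eq_top_of_perm_mem_of_collapse_mem (fun σ => ⟨P σ, DFunLike.congr_fun hP σ⟩)
    fun i j hij => ⟨S.e i j, funext (S.e_smul hij)⟩

end CollapseRelations

end CollapseRelations

section LongCycle

variable {n : ℕ}

lemma pt_inj {i j : ℕ} {hi : 1 ≤ i ∧ i ≤ n} {hj : 1 ≤ j ∧ j ≤ n} : pt i hi = pt j hj ↔ i = j := by
  simp only [pt, Fin.mk.injEq]
  omega

lemma nodup_pt (hn : 4 ≤ n) :
    [(pt 1 (by omega) : Fin n), pt 2 (by omega), pt 3 (by omega), pt n (by omega)].Nodup := by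
  simp [pt_inj]
  omega

lemma mem_drop_finRange {k : ℕ} {x : Fin n} : x ∈ (List.finRange n).drop k ↔ k ≤ x := by
  rw [List.mem_drop_iff_getElem]
  simp only [List.getElem_finRange, List.length_finRange, Fin.cast_mk, Fin.ext_iff, exists_prop]
  exact ⟨fun ⟨_, _, h⟩ => by omega, fun h => ⟨x - k, by omega⟩⟩

lemma isCycleOn_longCycle (h1 : 1 ≤ 1 ∧ 1 ≤ n) (h2 : 1 ≤ 2 ∧ 2 ≤ n) :
    (longCycle n).unop.IsCycleOn {pt 1 h1, pt 2 h2}ᶜ := by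
  have hset : ({pt 1 h1, pt 2 h2}ᶜ : Set (Fin n)) = {x | x ∈ (List.finRange n).drop 2} := by
    ext x
    change _ ↔ x ∈ (List.finRange n).drop 2
    rw [mem_drop_finRange]
    simp only [Set.mem_compl_iff, Set.mem_insert_iff, Set.mem_singleton_iff, pt, Fin.ext_iff]
    omega
  rw [hset]
  exact ((List.nodup_finRange n).sublist (List.drop_sublist 2 _)).isCycleOn_formPerm

lemma longCycle_unop_apply_of_lt {x : Fin n} (hx : x.val < 2) : (longCycle n).unop x = x :=
  List.formPerm_apply_of_notMem fun h => hx.not_ge (mem_drop_finRange.1 h)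

lemma longCycle_unop_pt_three (h3 : 1 ≤ 3 ∧ 3 ≤ n) (h4 : 1 ≤ 4 ∧ 4 ≤ n) :
    (longCycle n).unop (pt 3 h3) = pt 4 h4 := by
  have h := List.formPerm_apply_lt_getElem ((List.finRange n).drop 2)
    ((List.nodup_finRange n).sublist (List.drop_sublist 2 _)) 0 (by simp; omega)
  simpa [longCycle, pt] using h

end LongCycle

section Presentation

variable {n : ℕ} {A M : Type*} [Monoid M] {R : FreeMonoid A → FreeMonoid A → Prop}
  {p q : Fin 2 → FreeMonoid A} {r : Fin 4 → FreeMonoid A} {s : Fin 5 → FreeMonoid A}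
  {t u : FreeMonoid A}

lemma map_liftWord_eq {φ : FreeMonoid (Option A) →* M} {f : PresentedMonoid R →* M}
    (h : ∀ a, φ (FreeMonoid.of (some a)) = f (PresentedMonoid.of R a)) (w : FreeMonoid A) :
    φ (liftWord w) = f (PresentedMonoid.mk R w) := by
  have hcomp : φ.comp liftWord = f.comp (PresentedMonoid.mk R) := FreeMonoid.hom_eq h
  exact DFunLike.congr_fun hcomp w

variable (R p q r s t u) in
/-- The homomorphism from `⟨A | R⟩` to the monoid presented by `A ∪ {ζ}` and `TransRels R …`
induced by the inclusion of generators. -/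
def baseHom : PresentedMonoid R →* PresentedMonoid (TransRels R p q r s t u) :=
  PresentedMonoid.lift (fun a => PresentedMonoid.of _ (some a)) fun v w h => by
    have hlift : FreeMonoid.lift (fun a => PresentedMonoid.of (TransRels R p q r s t u) (some a)) =
        (PresentedMonoid.mk (TransRels R p q r s t u)).comp liftWord :=
      FreeMonoid.hom_eq fun a => rfl
    rw [hlift]
    exact PresentedMonoid.mk_eq_mk_of_rel (TransRels.ofBase h)

lemma forall_transRels_iff {φ : FreeMonoid (Option A) →* M}
    (hR : ∀ v w, R v w → φ (liftWord v) = φ (liftWord w)) :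
    (∀ v w, TransRels R p q r s t u v w → φ v = φ w) ↔
      φ (zeta * liftWord (p 0) * zeta * liftWord (p 1)) = φ zeta ∧
      φ (liftWord (q 0) * zeta) = φ (zeta * liftWord (q 1)) ∧
      φ (liftWord (r 0) * zeta * liftWord (r 1) * zeta) =
        φ (zeta * liftWord (r 2) * zeta * liftWord (r 3)) ∧
      φ (liftWord (s 0) * zeta * liftWord (s 1) * zeta * liftWord (s 2) * zeta * liftWord (s 3)) =
        φ (zeta * liftWord (s 4) * zeta) ∧
      φ (liftWord t * zeta) = φ (zeta * liftWord u) := by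
  refine ⟨fun h => ⟨h _ _ .rel1, h _ _ .rel3, h _ _ .rel7, h _ _ .rel8, h _ _ .rel9⟩,
    fun ⟨h1, h3, h7, h8, h9⟩ v w hvw => ?_⟩
  cases hvw with
  | ofBase h => exact hR _ _ h
  | rel1 => exact h1
  | rel3 => exact h3
  | rel7 => exact h7
  | rel8 => exact h8
  | rel9 => exact h9

lemma forall_transRels_iff_collapseRelations (hn : 4 ≤ n) (e : PresentedMonoid R ≃* SymGroup n)
    (hp : ∀ i, e (PresentedMonoid.mk R (p i)) = transp 1 3 (by omega) (by omega))
    (hq : ∀ i, e (PresentedMonoid.mk R (q i)) = transp 3 4 (by omega) (by omega))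
    (hr : ∀ i, e (PresentedMonoid.mk R (r i)) =
      transp 1 n (by omega) (by omega) * transp 2 3 (by omega) (by omega))
    (hs : ∀ i, e (PresentedMonoid.mk R (s i)) = transp 2 3 (by omega) (by omega))
    (ht : e (PresentedMonoid.mk R t) = longCycle n * transp 1 2 (by omega) (by omega))
    (hu : e (PresentedMonoid.mk R u) = longCycle n)
    {φ : FreeMonoid (Option A) →* Mᵐᵒᵖ} {P : Perm (Fin n) →* M}
    (hφ : ∀ a, φ (FreeMonoid.of (some a)) = MonoidHom.op P (e (PresentedMonoid.of R a))) :
    (∀ v w, TransRels R p q r s t u v w → φ v = φ w) ↔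
      CollapseRelations P (φ zeta).unop (pt 1 (by omega)) (pt 2 (by omega)) (pt 3 (by omega))
        (pt n (by omega)) (longCycle n).unop := by
  have hword (w : FreeMonoid A) : (φ (liftWord w)).unop = P (e (PresentedMonoid.mk R w)).unop :=
    congrArg _ (map_liftWord_eq (f := (MonoidHom.op P).comp e.toMonoidHom) hφ w)
  have hR (v w : FreeMonoid A) (h : R v w) : φ (liftWord v) = φ (liftWord w) :=
    MulOpposite.unop_injective (by rw [hword, hword, PresentedMonoid.mk_eq_mk_of_rel h])
  rw [forall_transRels_iff hR, collapseRelations_iff (nodup_pt hn),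
    longCycle_unop_pt_three _ (by omega)]
  simp only [← MulOpposite.unop_inj, map_mul φ, MulOpposite.unop_mul, hword, hp, hq, hr, hs, ht,
    hu, mul_assoc]
  rfl

/-- A homomorphism `Mᵐᵒᵖ →* N` regarded as a homomorphism `M →* Nᵐᵒᵖ`. -/
def opHom {M N : Type*} [Monoid M] [Monoid N] (f : Mᵐᵒᵖ →* N) : M →* Nᵐᵒᵖ :=
  MonoidHom.unop ((MulEquiv.opOp N).toMonoidHom.comp f)

/-- The homomorphism from `S_n`, acting on the left, to the opposite of the monoid presented by
`A ∪ {ζ}` and `TransRels R …`. -/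
def permHom (e : PresentedMonoid R ≃* SymGroup n) (p q r s t u) :
    Perm (Fin n) →* (PresentedMonoid (TransRels R p q r s t u))ᵐᵒᵖ :=
  opHom ((baseHom R p q r s t u).comp e.symm.toMonoidHom)

lemma permHom_unop (e : PresentedMonoid R ≃* SymGroup n) (a : A) :
    permHom e p q r s t u (e (PresentedMonoid.of R a)).unop =
      MulOpposite.op (PresentedMonoid.of _ (some a)) :=
  congrArg (MulOpposite.op ∘ baseHom R p q r s t u) (e.symm_apply_apply (PresentedMonoid.of R a))

lemma closure_insert_range_permHom (e : PresentedMonoid R ≃* SymGroup n) :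
    Submonoid.closure (insert (MulOpposite.op (PresentedMonoid.of _ none))
      (Set.range (permHom e p q r s t u))) = ⊤ := by
  refine top_unique ?_
  rw [← Submonoid.op_top, ← PresentedMonoid.closure_range_of, Submonoid.op_closure]
  refine Submonoid.closure_mono ?_
  rintro x ⟨_ | a, ha⟩
  · exact Or.inl (MulOpposite.unop_injective ha.symm)
  · exact Or.inr ⟨_, (permHom_unop e a).trans (congrArg MulOpposite.op ha)⟩

lemma comp_permHom (e : PresentedMonoid R ≃* SymGroup n) {P : Perm (Fin n) →* M}
    {F : PresentedMonoid (TransRels R p q r s t u) →* Mᵐᵒᵖ}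
    (hF : ∀ a, F (PresentedMonoid.of _ (some a)) = MonoidHom.op P (e (PresentedMonoid.of R a))) :
    ((MulEquiv.opOp M).symm.toMonoidHom.comp (MonoidHom.op F)).comp (permHom e p q r s t u) =
      P := by
  have hbase : F.comp (baseHom R p q r s t u) = (MonoidHom.op P).comp e.toMonoidHom :=
    PresentedMonoid.ext _ hF
  ext σ
  refine congrArg MulOpposite.unop ((DFunLike.congr_fun hbase (e.symm (MulOpposite.op σ))).trans ?_)
  exact congrArg (MonoidHom.op P) (e.apply_symm_apply _)

end Presentation

theorem theorem5_general (n : ℕ) (hn : 4 ≤ n) {A : Type*}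
    (R : FreeMonoid A → FreeMonoid A → Prop) (e : PresentedMonoid R ≃* SymGroup n)
    (p q : Fin 2 → FreeMonoid A) (r : Fin 4 → FreeMonoid A) (s : Fin 5 → FreeMonoid A)
    (t u : FreeMonoid A)
    (hp : ∀ i, e (PresentedMonoid.mk R (p i)) = transp 1 3 (by omega) (by omega))
    (hq : ∀ i, e (PresentedMonoid.mk R (q i)) = transp 3 4 (by omega) (by omega))
    (hr : ∀ i, e (PresentedMonoid.mk R (r i)) =
      transp 1 n (by omega) (by omega) * transp 2 3 (by omega) (by omega))
    (hs : ∀ i, e (PresentedMonoid.mk R (s i)) = transp 2 3 (by omega) (by omega))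
    (ht : e (PresentedMonoid.mk R t) = longCycle n * transp 1 2 (by omega) (by omega))
    (hu : e (PresentedMonoid.mk R u) = longCycle n) :
    ∃ E : PresentedMonoid (TransRels R p q r s t u) ≃* TransMonoid n,
      (∀ a : A, E (PresentedMonoid.of (TransRels R p q r s t u) (some a)) =
        permToTrans (e (PresentedMonoid.of R a))) ∧
      E (PresentedMonoid.of (TransRels R p q r s t u) none) =
        MulOpposite.op (collapse (pt 1 (by omega)) (pt 2 (by omega))) := by
  have habcd := nodup_pt hn
  have hz1 : (longCycle n).unop (pt 1 (by omega)) = pt 1 (by omega) :=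
    longCycle_unop_apply_of_lt (by simp [pt])
  have hz2 : (longCycle n).unop (pt 2 (by omega)) = pt 2 (by omega) :=
    longCycle_unop_apply_of_lt (by simp [pt])
  let gen : Option A → TransMonoid n
    | none => MulOpposite.op (collapse (pt 1 (by omega)) (pt 2 (by omega)))
    | some a => permToTrans (e (PresentedMonoid.of R a))
  have hgen : ∀ v w, TransRels R p q r s t u v w → FreeMonoid.lift gen v = FreeMonoid.lift gen w :=
    (forall_transRels_iff_collapseRelations hn e hp hq hr hs ht hu (P := MulAction.toEndHom)
      fun a => rfl).2 (collapseRelations_collapse habcd hz1 hz2)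
  have hrel := (forall_transRels_iff_collapseRelations hn e hp hq hr hs ht hu
    (φ := (MulEquiv.opOp _).toMonoidHom.comp (PresentedMonoid.mk (TransRels R p q r s t u)))
    (P := permHom e p q r s t u) fun a => congrArg MulOpposite.op (permHom_unop e a).symm).1
      fun v w h => congrArg (MulEquiv.opOp _) (PresentedMonoid.mk_eq_mk_of_rel h)
  let F : PresentedMonoid (TransRels R p q r s t u) →* TransMonoid n :=
    PresentedMonoid.lift gen hgen
  have hF := hrel.bijective habcd hz1 hz2 (isCycleOn_longCycle _ _)
    (closure_insert_range_permHom e) (comp_permHom e (F := F) fun a => rfl) rfl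
  exact ⟨MulEquiv.ofBijective F
    (MulOpposite.opEquiv.bijective.comp (hF.comp MulOpposite.opEquiv.bijective)),
    fun a => rfl, rfl⟩

theorem theorem5 (n : ℕ) (hn : 5 ≤ n) {A : Type*}
    (R : FreeMonoid A → FreeMonoid A → Prop)
    -- `⟨A | R⟩` is a monoid presentation for `S_n`
    (e : PresentedMonoid R ≃* SymGroup n)
    -- arbitrary words over `A` representing the permutations that occur in the relations
    (p q : Fin 2 → FreeMonoid A) (r : Fin 4 → FreeMonoid A) (s : Fin 5 → FreeMonoid A)
    (t u : FreeMonoid A)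
    (hp : ∀ i, e (PresentedMonoid.mk R (p i)) = transp 1 3 (by omega) (by omega))
    (hq : ∀ i, e (PresentedMonoid.mk R (q i)) = transp 3 4 (by omega) (by omega))
    (hr : ∀ i, e (PresentedMonoid.mk R (r i)) =
      transp 1 n (by omega) (by omega) * transp 2 3 (by omega) (by omega))
    (hs : ∀ i, e (PresentedMonoid.mk R (s i)) = transp 2 3 (by omega) (by omega))
    (ht : e (PresentedMonoid.mk R t) = longCycle n * transp 1 2 (by omega) (by omega))
    (hu : e (PresentedMonoid.mk R u) = longCycle n) :
    ∃ E : PresentedMonoid (TransRels R p q r s t u) ≃* TransMonoid n,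
      (∀ a : A, E (PresentedMonoid.of (TransRels R p q r s t u) (some a)) =
        permToTrans (e (PresentedMonoid.of R a))) ∧
      E (PresentedMonoid.of (TransRels R p q r s t u) none) = idem n hn :=
  theorem5_general n (by omega) R e p q r s t u hp hq hr hs ht hu
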